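/- Let $\mathbb H$ be the real algebra of quaternions. A quaternionic Hilbert space is a nonzero right $\mathbb H$-module $\mathsf H$ with a scalar product $\langle\cdot|\cdot\rangle:\mathsf H\times\mathsf H\to\mathbb H$ such that $\langle u|vp+wq\rangle=\langle u|v\rangle p+\langle u|w\rangle q$, $\langle u|v\rangle=\overline{\langle v|u\rangle}$, $\langle u|u\rangle\in[0,+\infty)$, with $\langle u|u\rangle=0$ only for $u=0$, which is complete for the norm $\|u\|=\sqrt{\langle u|u\rangle}$. Let $\mathfrak B(\mathsf H)$ be the real algebra of bounded right $\mathbb H$-linear operators $\mathsf H\to\mathsf H$, with the operator norm and $(Tr)(u):=T(u)r$ for $r\in\mathbb R$; the adjoint $T^*\in\mathfrak B(\mathsf H)$ is given by $\langle T^*u|v\rangle=\langle u|Tv\rangle$, and $T$ is self-adjoint if $T=T^*$ and normal if $TT^*=T^*T$. For $T\in\mathfrak B(\mathsf H)$ and $q\in\mathbb H$ put $\Delta_q(T):=T^2-T(q+\overline q)+\mathrm I|q|^2$. The spherical resolvent set $\rho_S(T)$ is the set of $q\in\mathbb H$ such that $\mathrm{Ker}(\Delta_q(T))=\{0\}$,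 $\mathrm{Ran}(\Delta_q(T))$ is dense in $\mathsf H$, and $\Delta_q(T)^{-1}:\mathrm{Ran}(\Delta_q(T))\to\mathsf H$ is bounded. The spherical spectrum is $\sigma_S(T):=\mathbb H\setminus\rho_S(T)$ and the spherical spectral radius is $r_S(T):=\sup\{|q| : q\in\sigma_S(T)\}\in[0,+\infty]$. Theorem. Let $\mathsf H$ be a quaternionic Hilbert space and let $T\in\mathfrak B(\mathsf H)$. Then: (a) Let $q\in\mathbb H$ with $|q|>\|T\|$ and, for $n\in\mathbb N=\{0,1,2,\dots\}$, put $a_n:=|q|^{-2n-2}\sum_{h=0}^n q^h\,\overline q^{\,n-h}$. Then every $a_n$ is real, $\Delta_q(T)$ is invertible in $\mathfrak B(\mathsf H)$, and the series $\sum_{n\in\mathbb N}T^na_n$ converges absolutely in $\mathfrak B(\mathsf H)$ with respect to the operator norm to $\Delta_q(T)^{-1}$. In particular, $r_S(T)\le\|T\|$. (b) $\sigma_S(T)$ is a nonempty compact subset of $\mathbb H$. (c) If $T$ is self-adjoint, then for every real polynomial $P(X)=\sum_{h=0}^d X^hr_h\in\mathbb R[X]$, with $P(T):=\sum_{h=0}^d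 T^hr_h$, one has $\sigma_S(P(T))=P(\sigma_S(T)):=\{P(q) : q\in\sigma_S(T)\}$. (d) For every $n\in\mathbb N$, $\sigma_S(T^n)=\sigma_S(T)^n:=\{q^n : q\in\sigma_S(T)\}$. (e) $r_S(T)=\lim_{n\to+\infty}\|T^n\|^{1/n}$. In particular, if $T$ is normal, then $r_S(T)=\|T\|$. -/

import Mathlib

open scoped Quaternion Topology ENNReal

noncomputable section

open scoped RightActions in
/-- A Hermitean quaternionic scalar product on a right `ℍ`-module `H` whose norm is
`‖u‖ = √⟨u|u⟩`, i.e. a quaternionic pre-Hilbert space.  Right `ℍ`-modules are modules over `ℍᵐᵒᵖ`,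
and `u <• q` is the right scalar multiple `u q`.  The last axiom says that `⟨u|u⟩` is the real
number `‖u‖ ^ 2`, so it contains the positivity of the scalar product.
A quaternionic Hilbert space is such a space which is complete and nonzero. -/
class QuaternionicInnerProductSpace (H : Type*) [NormedAddCommGroup H]
    extends Module ℍᵐᵒᵖ H, Inner ℍ H where
  inner_right_linear : ∀ (u v w : H) (p q : ℍ),
    inner u (v <• p + w <• q) = inner u v * p + inner u w * q
  inner_hermitian : ∀ u v : H, inner u v = star (inner v u)
  inner_self : ∀ u : H, inner u u = ((‖u‖ ^ 2 : ℝ) : ℍ)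

namespace QuaternionicHilbert

section Basic

variable {H : Type*} [NormedAddCommGroup H] [QuaternionicInnerProductSpace H]

open QuaternionicInnerProductSpace
open scoped RightActions

theorem inner_add_right (u v w : H) : inner ℍ u (v + w) = inner ℍ u v + inner ℍ u w := by
  simpa using inner_right_linear u v w 1 1

theorem inner_smul_right (u v : H) (q : ℍ) : inner ℍ u (v <• q) = inner ℍ u v * q := by
  simpa using inner_right_linear u v v q 0

theorem inner_add_left (u v w : H) : inner ℍ (u + v) w = inner ℍ u w + inner ℍ v w := by
  rw [inner_hermitian, inner_add_right, star_add, ← inner_hermitian, ← inner_hermitian]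

theorem inner_smul_left (u v : H) (q : ℍ) : inner ℍ (u <• q) v = star q * inner ℍ u v := by
  rw [inner_hermitian, inner_smul_right, star_mul, ← inner_hermitian]

/-- The underlying real vector space: `r • u = u r` for `r : ℝ`. -/
abbrev moduleReal : Module ℝ H := Module.compHom H (algebraMap ℝ ℍᵐᵒᵖ)

theorem norm_sq_eq (u : H) : ‖u‖ ^ 2 = (inner ℍ u u).re := by
  rw [QuaternionicInnerProductSpace.inner_self u, Quaternion.re_coe]

/-- The underlying real inner product space, with scalar product `Re ⟨u|v⟩`. -/
instance instInnerProductSpaceReal : InnerProductSpace ℝ H :=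
  { (moduleReal : Module ℝ H) with
    norm_smul_le := fun r u => by
      refine le_of_eq ((sq_eq_sq₀ (norm_nonneg _) (by positivity)).1 ?_)
      change ‖u <• (r : ℍ)‖ ^ 2 = _
      rw [norm_sq_eq, inner_smul_left, inner_smul_right,
        QuaternionicInnerProductSpace.inner_self u, mul_pow, Real.norm_eq_abs, sq_abs]
      simp only [Quaternion.star_coe, ← Quaternion.coe_mul, Quaternion.re_coe]
      ring
    inner := fun u v => (inner ℍ u v).re
    norm_sq_eq_re_inner := norm_sq_eq
    conj_inner_symm := fun u v => by
      change (inner ℍ v u).re = (inner ℍ u v).re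
      rw [inner_hermitian v u, Quaternion.re_star]
    add_left := fun u v w => by
      change (inner ℍ (u + v) w).re = (inner ℍ u w).re + (inner ℍ v w).re
      rw [inner_add_left, Quaternion.re_add]
    smul_left := fun u v r => by
      change (inner ℍ (u <• (r : ℍ)) v).re = r * (inner ℍ u v).re
      rw [inner_smul_left, Quaternion.star_coe, Quaternion.coe_mul_eq_smul, Quaternion.re_smul,
        smul_eq_mul] }

theorem real_smul_def (r : ℝ) (u : H) : r • u = u <• (r : ℍ) := rfl

theorem real_inner_def (u v : H) : inner ℝ u v = (inner ℍ u v).re := rfl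

instance instIsScalarTower : IsScalarTower ℝ ℍᵐᵒᵖ H where
  smul_assoc r q u := by
    change (r • q) • u = (algebraMap ℝ ℍᵐᵒᵖ r) • (q • u)
    rw [smul_smul, Algebra.smul_def]

instance instSMulCommClass : SMulCommClass ℍᵐᵒᵖ ℝ H where
  smul_comm q r u := by
    change q • (algebraMap ℝ ℍᵐᵒᵖ r) • u = (algebraMap ℝ ℍᵐᵒᵖ r) • (q • u)
    rw [smul_smul, smul_smul, Algebra.commutes]

end Basic

/-- `𝔅(H)`: the everywhere defined bounded (equivalently, continuous) right `ℍ`-linear operators. -/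
abbrev BoundedOperator (H : Type*) [NormedAddCommGroup H] [QuaternionicInnerProductSpace H] :=
  H →L[ℍᵐᵒᵖ] H

section Operators

open scoped RightActions

variable {H : Type*} [NormedAddCommGroup H] [QuaternionicInnerProductSpace H]

/-- The real algebra structure of `𝔅(H)`: the product is the composition, `(r • T) u = (T u) r`. -/
instance instAlgebraReal : Algebra ℝ (BoundedOperator H) :=
  Algebra.ofModule (fun r S T => by ext u; rfl)
    (fun r S T => by
      ext u
      change S (r • T u) = r • S (T u)
      exact S.map_smul_of_tower r (T u))

/-- Forgetting the quaternionic linearity. -/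
def toReal : BoundedOperator H →ₐ[ℝ] (H →L[ℝ] H) where
  toFun T := T.restrictScalars ℝ
  map_one' := rfl
  map_mul' _ _ := rfl
  map_zero' := rfl
  map_add' _ _ := rfl
  commutes' _ := rfl

theorem toReal_injective : Function.Injective (toReal (H := H)) := fun S T h => by
  ext u
  exact congrArg (fun A : H →L[ℝ] H => A u) h

/-- The operator norm of `𝔅(H)`. It depends only on the underlying map. -/
instance instNormedRing : NormedRing (BoundedOperator H) :=
  NormedRing.induced (BoundedOperator H) (H →L[ℝ] H) toReal toReal_injective

theorem norm_def (T : BoundedOperator H) :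
    ‖T‖ = sInf {K : ℝ | 0 ≤ K ∧ ∀ u : H, ‖T u‖ ≤ K * ‖u‖} := rfl

/-- The underlying map of the adjoint: the adjoint for `Re ⟨u|v⟩`, which is right `ℍ`-linear. -/
def adjoint [CompleteSpace H] (T : BoundedOperator H) : BoundedOperator H where
  toFun := ContinuousLinearMap.adjoint (toReal T)
  map_add' := map_add _
  map_smul' q u := by
    have key (x y : H) : (inner ℍ (ContinuousLinearMap.adjoint (toReal T) x) y).re =
        (inner ℍ x (T y)).re := ContinuousLinearMap.adjoint_inner_left (toReal T) y x
    have hcomm (a b : ℍ) : (a * b).re = (b * a).re := by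
      simp only [Quaternion.re_mul]; ring
    refine ext_inner_right ℝ fun v => ?_
    obtain ⟨q, rfl⟩ := MulOpposite.op_surjective q
    simp only [real_inner_def, RingHom.id_apply]
    rw [key, inner_smul_left, hcomm, ← inner_smul_right, inner_smul_left, hcomm,
      ← inner_smul_right, key]
    congr 2
    exact (T.map_smul _ _).symm
  cont := (ContinuousLinearMap.adjoint (toReal T)).continuous

/-- `T ↦ T*`; with it `IsSelfAdjoint T` is `T* = T` and `IsStarNormal T` is `T* T = T T*`. -/
instance instStar [CompleteSpace H] : Star (BoundedOperator H) := ⟨adjoint⟩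

/-- The defining property of the adjoint: `⟨T* u | v⟩ = ⟨u | T v⟩`. -/
theorem inner_star_left [CompleteSpace H] (T : BoundedOperator H) (u v : H) :
    inner ℍ (star T u) v = inner ℍ u (T v) := by
  have key (y : H) : (inner ℍ (star T u) y).re = (inner ℍ u (T y)).re :=
    ContinuousLinearMap.adjoint_inner_left (toReal T) y u
  have h (q : ℍ) : ((inner ℍ (star T u) v - inner ℍ u (T v)) * q).re = 0 := by
    have := key (v <• q)
    rw [T.map_smul, inner_smul_right, inner_smul_right] at this
    rw [sub_mul, Quaternion.re_sub, this, sub_self]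
  have h2 := h (star (inner ℍ (star T u) v - inner ℍ u (T v)))
  rw [Quaternion.self_mul_star, Quaternion.re_coe, Quaternion.normSq_eq_zero] at h2
  exact sub_eq_zero.1 h2

/-- `Δ_q(T) = T² - T (q + q̄) + I |q|²`, where `q + q̄ = 2 Re q`. -/
def Delta (q : ℍ) (T : BoundedOperator H) : BoundedOperator H :=
  T ^ 2 - (2 * q.re) • T + (‖q‖ ^ 2) • (1 : BoundedOperator H)

theorem Delta_apply (q : ℍ) (T : BoundedOperator H) (u : H) :
    Delta q T u = T (T u) - T u <• (q + star q) + u <• ((‖q‖ ^ 2 : ℝ) : ℍ) := by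
  rw [Quaternion.self_add_star]
  change T (T u) - (2 * q.re) • T u + (‖q‖ ^ 2) • u = _
  rw [real_smul_def, real_smul_def, Quaternion.coe_mul]
  rfl

/-- The spherical resolvent set of `T`: `Δ_q(T)` has trivial kernel, dense range, and its inverse
`Ran Δ_q(T) → H` is bounded. -/
def sphericalResolventSet (T : BoundedOperator H) : Set ℍ :=
  {q | (∀ u : H, Delta q T u = 0 → u = 0) ∧ Dense (Set.range (Delta q T)) ∧
    ∃ K : ℝ, ∀ u : H, ‖u‖ ≤ K * ‖Delta q T u‖}

/-- The spherical spectrum `σ_S(T)`. -/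
def sphericalSpectrum (T : BoundedOperator H) : Set ℍ := (sphericalResolventSet T)ᶜ

/-- The spherical spectral radius `r_S(T) = sup {|q| : q ∈ σ_S(T)}`, in `[0, +∞]`. -/
def sphericalSpectralRadius (T : BoundedOperator H) : ℝ≥0∞ :=
  ⨆ q ∈ sphericalSpectrum T, ENNReal.ofReal ‖q‖

end Operators

end QuaternionicHilbert

end

open QuaternionicHilbert

/-! Restricting the right scalars from `ℍ` to `ℂ` turns `H` into a complex Hilbert space with the
same norm, and `T` into a complex operator, `toComplex T`. If `z : ℂ` has the real part and norm of
`q`, then `Δ_q(T) = (z - T)(z̄ - T)` over `ℂ`. Right multiplication by `j` conjugates one factor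
into the other, so both are invertible or neither is. Hence `q ∈ σ_S(T)` exactly when `z` lies in
the ordinary spectrum (`mem_sphericalSpectrum_iff`).

Every quaternion is `φ z` for a real algebra map `φ : ℂ → ℍ`. Such maps preserve real part and norm
and commute with real polynomials. Nonemptiness, polynomial spectral mapping, Gelfand's formula and
the normal case therefore transfer from complex spectral theory.

For the power series, the coefficients satisfy the linear recurrence with characteristic roots `q`
and `q̄`, rescaled. Multiplying a partial sum by `Δ_q(T)` thus leaves `1` plus two boundary terms
tending to zero. -/

noncomputable section

namespace QuaternionicHilbert

/-! ### Restriction of scalars to `ℂ`, and the role of `j` -/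

section ComplexStructure

open scoped RightActions ComplexConjugate

variable {H : Type*} [NormedAddCommGroup H] [QuaternionicInnerProductSpace H]

/-- The inclusion `ℂ ⊂ ℍ`, with values in the opposite ring. -/
def complexToOp : ℂ →+* ℍᵐᵒᵖ :=
  (Quaternion.ofComplex : ℂ →+* ℍ).toOpposite fun z w => by
    rw [Commute, SemiconjBy, ← map_mul, mul_comm, map_mul]

/-- The underlying complex vector space: `z • u = u z` for `z : ℂ ⊂ ℍ`. -/
abbrev moduleComplex : Module ℂ H := Module.compHom H complexToOp

/-- The complex component of a quaternion. -/
def complexPart (q : ℍ) : ℂ := ⟨q.re, q.imI⟩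

/-- The underlying complex Hilbert space: its scalar product is the complex component of
`⟨u|v⟩`. -/
abbrev innerProductSpaceComplex : InnerProductSpace ℂ H :=
  { (moduleComplex : Module ℂ H) with
    norm_smul_le := fun z u => by
      refine le_of_eq ((sq_eq_sq₀ (norm_nonneg _) (by positivity)).1 ?_)
      change ‖u <• (z : ℍ)‖ ^ 2 = _
      rw [norm_sq_eq, inner_smul_left, inner_smul_right,
        QuaternionicInnerProductSpace.inner_self u, mul_pow, Complex.sq_norm, Complex.normSq_apply]
      simp only [Quaternion.re_mul, Quaternion.re_star, Quaternion.imI_star, Quaternion.imJ_star,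
        Quaternion.imK_star, Quaternion.re_coe, Quaternion.imI_coe, Quaternion.imJ_coe,
        Quaternion.imK_coe, Quaternion.imI_mul, Quaternion.imJ_mul, Quaternion.imK_mul,
        Quaternion.re_coeComplex, Quaternion.imI_coeComplex, Quaternion.imJ_coeComplex,
        Quaternion.imK_coeComplex]
      ring
    inner := fun u v => complexPart (inner ℍ u v)
    norm_sq_eq_re_inner := norm_sq_eq
    conj_inner_symm := fun u v => by
      change conj (complexPart (inner ℍ v u)) = complexPart (inner ℍ u v)
      rw [QuaternionicInnerProductSpace.inner_hermitian u v]
      apply Complex.ext <;> simp [complexPart]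
    add_left := fun u v w => by
      change complexPart (inner ℍ (u + v) w) = complexPart (inner ℍ u w) + complexPart (inner ℍ v w)
      rw [inner_add_left]
      apply Complex.ext <;> simp [complexPart]
    smul_left := fun u v z => by
      change complexPart (inner ℍ (u <• (z : ℍ)) v) = conj z * complexPart (inner ℍ u v)
      rw [inner_smul_left]
      apply Complex.ext <;> simp [complexPart] }

attribute [local instance] innerProductSpaceComplex

theorem complex_smul_def (z : ℂ) (u : H) : z • u = u <• (z : ℍ) := rfl

theorem complex_inner_def (u v : H) : inner ℂ u v = complexPart (inner ℍ u v) := rfl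

theorem complex_ofReal_smul (r : ℝ) (u : H) : (r : ℂ) • u = u <• (r : ℍ) := by
  rw [complex_smul_def, Quaternion.coeComplex_coe]

/-- A bounded quaternionic operator, as an operator of the underlying complex Hilbert space. -/
def toComplex : BoundedOperator H →+* (H →L[ℂ] H) where
  toFun T :=
    { toFun := T
      map_add' := T.map_add
      map_smul' := fun z u => T.map_smul (complexToOp z) u
      cont := T.continuous }
  map_one' := rfl
  map_mul' _ _ := rfl
  map_zero' := rfl
  map_add' _ _ := rfl

theorem toComplex_apply (T : BoundedOperator H) (u : H) : toComplex T u = T u := rfl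

theorem norm_toComplex (T : BoundedOperator H) : ‖toComplex T‖ = ‖T‖ := rfl

theorem toComplex_real_smul (r : ℝ) (T : BoundedOperator H) :
    toComplex (r • T) = (r : ℂ) • toComplex T := by
  ext u
  exact (complex_ofReal_smul r (T u)).symm

theorem toComplex_aeval (T : BoundedOperator H) (P : Polynomial ℝ) :
    toComplex (Polynomial.aeval T P) =
      Polynomial.aeval (toComplex T) (P.map (algebraMap ℝ ℂ)) := by
  induction P using Polynomial.induction_on' with
  | add p q hp hq => simp only [map_add, Polynomial.map_add, hp, hq]
  | monomial n r =>
    rw [Polynomial.aeval_monomial, Polynomial.map_monomial, Polynomial.aeval_monomial,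
      ← Algebra.smul_def, ← Algebra.smul_def, toComplex_real_smul, map_pow]
    rfl

theorem toComplex_star [CompleteSpace H] (T : BoundedOperator H) :
    toComplex (star T) = star (toComplex T) := by
  rw [ContinuousLinearMap.star_eq_adjoint, ContinuousLinearMap.eq_adjoint_iff]
  intro u v
  rw [complex_inner_def, complex_inner_def, toComplex_apply, toComplex_apply, inner_star_left]

/-- `Δ_q` depends on `q` only through its real part and norm, which are also the data of the real
quadratic with roots `z` and `z̄`. -/
theorem toComplex_Delta (T : BoundedOperator H) {q : ℍ} {z : ℂ} (hre : q.re = z.re)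
    (hnorm : ‖q‖ = ‖z‖) :
    toComplex (Delta q T) = (algebraMap ℂ _ z - toComplex T) *
      (algebraMap ℂ _ (conj z) - toComplex T) := by
  have h1 : ((2 * z.re : ℝ) : ℂ) = z + conj z := by rw [Complex.add_conj]
  have h2 : ((‖z‖ ^ 2 : ℝ) : ℂ) = z * conj z := by rw [Complex.mul_conj, Complex.sq_norm]
  rw [Delta, hre, hnorm, map_add, map_sub, toComplex_real_smul, toComplex_real_smul, h1, h2,
    map_pow, map_one, Algebra.smul_def, Algebra.smul_def, map_add, map_mul, mul_one, sub_mul,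
    mul_sub, mul_sub, ← Algebra.commutes (conj z) (toComplex T)]
  noncomm_ring

/-- The quaternion unit `j`. -/
def unitJ : ℍ := ⟨0, 0, 1, 0⟩

@[simp] theorem re_unitJ : unitJ.re = 0 := rfl

@[simp] theorem imI_unitJ : unitJ.imI = 0 := rfl

@[simp] theorem imJ_unitJ : unitJ.imJ = 1 := rfl

@[simp] theorem imK_unitJ : unitJ.imK = 0 := rfl

theorem unitJ_mul_coeComplex_conj (z : ℂ) : unitJ * ((conj z : ℂ) : ℍ) = (z : ℍ) * unitJ := by
  ext <;> simp

theorem unitJ_mul_unitJ : unitJ * unitJ = -1 := by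
  ext <;> simp

theorem bijective_smul_unitJ : Function.Bijective fun u : H => u <• unitJ := by
  have h (a b : ℍ) (hab : a * b = 1) (u : H) : u <• a <• b = u := by
    rw [smul_smul, ← MulOpposite.op_mul, hab, MulOpposite.op_one, one_smul]
  refine Function.bijective_iff_has_inverse.2 ⟨fun u => u <• (-unitJ), ?_, ?_⟩
  · exact h _ _ (by rw [mul_neg, unitJ_mul_unitJ, neg_neg])
  · exact h _ _ (by rw [neg_mul, unitJ_mul_unitJ, neg_neg])

/-- `T` commutes with right multiplication by `j`, while `j z̄ = z j`. This is where linearity over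
`ℍ`, not just `ℂ`, enters. -/
theorem sub_toComplex_conj_smul_unitJ (T : BoundedOperator H) (z : ℂ) (u : H) :
    (algebraMap ℂ (H →L[ℂ] H) (conj z) - toComplex T) (u <• unitJ) =
      (algebraMap ℂ (H →L[ℂ] H) z - toComplex T) u <• unitJ := by
  have h1 (w : ℂ) (v : H) : (algebraMap ℂ (H →L[ℂ] H) w - toComplex T) v = v <• (w : ℍ) - T v := rfl
  rw [h1, h1, T.map_smul, smul_sub, smul_smul, smul_smul, ← MulOpposite.op_mul,
    ← MulOpposite.op_mul, unitJ_mul_coeComplex_conj]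

theorem isUnit_sub_toComplex_conj [CompleteSpace H] (T : BoundedOperator H) (z : ℂ) :
    IsUnit (algebraMap ℂ (H →L[ℂ] H) (conj z) - toComplex T) ↔
      IsUnit (algebraMap ℂ (H →L[ℂ] H) z - toComplex T) := by
  rw [ContinuousLinearMap.isUnit_iff_bijective, ContinuousLinearMap.isUnit_iff_bijective,
    ← Function.Bijective.of_comp_iff _ (bijective_smul_unitJ (H := H)),
    ← Function.Bijective.of_comp_iff' (bijective_smul_unitJ (H := H))
      (algebraMap ℂ (H →L[ℂ] H) z - toComplex T)]
  rw [show _ ∘ _ = _ ∘ _ from funext (sub_toComplex_conj_smul_unitJ T z)]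

theorem isUnit_toComplex_Delta [CompleteSpace H] (T : BoundedOperator H) {q : ℍ} {z : ℂ}
    (hre : q.re = z.re) (hnorm : ‖q‖ = ‖z‖) :
    IsUnit (toComplex (Delta q T)) ↔ z ∉ spectrum ℂ (toComplex T) := by
  have hc : Commute (algebraMap ℂ (H →L[ℂ] H) z - toComplex T)
      (algebraMap ℂ _ (conj z) - toComplex T) :=
    (Algebra.commute_algebraMap_left z _).sub_left
      ((Algebra.commute_algebraMap_right _ _).sub_right (Commute.refl _))
  rw [toComplex_Delta T hre hnorm, hc.isUnit_mul_iff, isUnit_sub_toComplex_conj, and_self,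
    spectrum.notMem_iff]

theorem mem_sphericalResolventSet_iff [CompleteSpace H] (T : BoundedOperator H) (q : ℍ) :
    q ∈ sphericalResolventSet T ↔ IsUnit (toComplex (Delta q T)) := by
  constructor
  · rintro ⟨hker, hdense, K, hK⟩
    have hK' (u : H) : ‖u‖ ≤ K.toNNReal * ‖toComplex (Delta q T) u‖ :=
      (hK u).trans (mul_le_mul_of_nonneg_right (Real.le_coe_toNNReal K) (norm_nonneg _))
    -- Bounded below on a complete space: the range is closed, and being dense it is everything.
    have hanti := AddMonoidHomClass.antilipschitz_of_bound (toComplex (Delta q T)) hK'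
    have hclosed := hanti.isClosed_range (toComplex (Delta q T)).uniformContinuous
    rw [ContinuousLinearMap.isUnit_iff_bijective]
    refine ⟨hanti.injective, Set.range_eq_univ.1 ?_⟩
    rw [← hclosed.closure_eq]
    exact hdense.closure_eq
  · intro h
    have hbij := ContinuousLinearMap.isUnit_iff_bijective.1 h
    obtain ⟨S, hS⟩ := h.exists_left_inv
    have hS' (u : H) : S (Delta q T u) = u := congrArg (fun A : H →L[ℂ] H => A u) hS
    refine ⟨fun u hu => ?_, ?_, ‖S‖, fun u => ?_⟩
    · rw [← hS' u, hu, map_zero]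
    · exact hbij.surjective.denseRange
    · conv_lhs => rw [← hS' u]
      exact S.le_opNorm _

theorem isUnit_of_isUnit_toComplex {S : BoundedOperator H} (h : IsUnit (toComplex S)) :
    IsUnit S := by
  obtain ⟨R, hl⟩ := h.exists_left_inv
  obtain ⟨R', hr⟩ := h.exists_right_inv
  have hR : R' = R := (left_inv_eq_right_inv hl hr).symm
  subst hR
  have hl' (u : H) : R' (S u) = u := congrArg (fun A : H →L[ℂ] H => A u) hl
  have hr' (u : H) : S (R' u) = u := congrArg (fun A : H →L[ℂ] H => A u) hr
  let B : BoundedOperator H :=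
    { toFun := R'
      map_add' := map_add R'
      map_smul' := fun q u => by
        -- The inverse of an `ℍ`-linear bijection is `ℍ`-linear, though `R'` is only given as
        -- `ℂ`-linear.
        rw [RingHom.id_apply, ← hl' (q • R' u), S.map_smul, hr']
      cont := R'.continuous }
  exact ⟨⟨S, B, ContinuousLinearMap.ext hr', ContinuousLinearMap.ext hl'⟩, rfl⟩

/-- The spherical spectrum consists of the quaternions similar to a point of the spectrum of the
underlying complex operator. -/
theorem mem_sphericalSpectrum_iff [CompleteSpace H] (T : BoundedOperator H) {q : ℍ} {z : ℂ}
    (hre : q.re = z.re) (hnorm : ‖q‖ = ‖z‖) :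
    q ∈ sphericalSpectrum T ↔ z ∈ spectrum ℂ (toComplex T) := by
  rw [sphericalSpectrum, Set.mem_compl_iff, mem_sphericalResolventSet_iff,
    isUnit_toComplex_Delta T hre hnorm, not_not]

end ComplexStructure

end QuaternionicHilbert

end

noncomputable section

namespace QuaternionicHilbert

/-! ### Copies of `ℂ` inside `ℍ` -/

section Slices

open scoped ComplexConjugate

theorem re_eq_zero_of_mul_self_eq_neg_one {q : ℍ} (h : q * q = -1) : q.re = 0 := by
  have h0 := congrArg (fun p : ℍ => p.re) h
  have h1 := congrArg (fun p : ℍ => p.imI) h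
  have h2 := congrArg (fun p : ℍ => p.imJ) h
  have h3 := congrArg (fun p : ℍ => p.imK) h
  simp only [Quaternion.re_mul, Quaternion.imI_mul, Quaternion.imJ_mul, Quaternion.imK_mul,
    Quaternion.re_neg, Quaternion.imI_neg, Quaternion.imJ_neg, Quaternion.imK_neg,
    Quaternion.re_one, Quaternion.imI_one, Quaternion.imJ_one, Quaternion.imK_one] at h0 h1 h2 h3
  -- The imaginary components of `q * q` are `2 * q.re` times those of `q`. If `q.re ≠ 0`, then `q`
  -- is real and its square cannot be `-1`.
  by_contra hq
  have e1 : q.imI = 0 := mul_left_cancel₀ hq (by linarith)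
  have e2 : q.imJ = 0 := mul_left_cancel₀ hq (by linarith)
  have e3 : q.imK = 0 := mul_left_cancel₀ hq (by linarith)
  rw [e1, e2, e3] at h0
  nlinarith [mul_self_nonneg q.re]

theorem algHom_I_mul_self (φ : ℂ →ₐ[ℝ] ℍ) : φ Complex.I * φ Complex.I = -1 := by
  rw [← map_mul, Complex.I_mul_I, map_neg, map_one]

theorem algHom_apply (φ : ℂ →ₐ[ℝ] ℍ) (z : ℂ) : φ z = (z.re : ℍ) + z.im • φ Complex.I := by
  conv_lhs => rw [← Complex.re_add_im z]
  rw [map_add, ← Complex.coe_algebraMap, AlgHom.commutes, ← Algebra.smul_def, map_smul]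
  rfl

theorem re_algHom (φ : ℂ →ₐ[ℝ] ℍ) (z : ℂ) : (φ z).re = z.re := by
  rw [algHom_apply, Quaternion.re_add, Quaternion.re_smul,
    re_eq_zero_of_mul_self_eq_neg_one (algHom_I_mul_self φ), smul_zero, add_zero,
    Quaternion.re_coe]

theorem star_algHom (φ : ℂ →ₐ[ℝ] ℍ) (z : ℂ) : star (φ z) = φ (conj z) := by
  have h : star (φ Complex.I) = -φ Complex.I :=
    Quaternion.star_eq_neg.2 (re_eq_zero_of_mul_self_eq_neg_one (algHom_I_mul_self φ))
  rw [algHom_apply, algHom_apply φ (conj z), star_add, Quaternion.star_smul, h, Complex.conj_re,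
    Complex.conj_im, Quaternion.star_coe, neg_smul, smul_neg]

theorem norm_algHom (φ : ℂ →ₐ[ℝ] ℍ) (z : ℂ) : ‖φ z‖ = ‖z‖ := by
  refine (sq_eq_sq₀ (norm_nonneg _) (norm_nonneg _)).1 ?_
  have h : ((‖φ z‖ ^ 2 : ℝ) : ℍ) = ((‖z‖ ^ 2 : ℝ) : ℍ) := by
    rw [pow_two, ← Quaternion.normSq_eq_norm_mul_self, ← Quaternion.self_mul_star, star_algHom,
      ← map_mul, Complex.mul_conj, Complex.sq_norm]
    exact φ.commutes _
  exact Quaternion.coe_injective h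

/-- Every quaternion lies in a slice, i.e. in a copy of `ℂ` in `ℍ`. -/
theorem exists_algHom_apply_eq (q : ℍ) : ∃ (φ : ℂ →ₐ[ℝ] ℍ) (z : ℂ), φ z = q := by
  by_cases hq : q.im = 0
  · refine ⟨Quaternion.ofComplex, q.re, ?_⟩
    rw [Quaternion.coe_ofComplex, Quaternion.coeComplex_coe]
    conv_rhs => rw [← Quaternion.re_add_im q, hq, add_zero]
  -- The normalised imaginary part is a square root of `-1`; it serves as the image of `Complex.I`.
  · have hn : ‖q.im‖ ≠ 0 := norm_ne_zero_iff.2 hq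
    have hI : (‖q.im‖⁻¹ • q.im) * (‖q.im‖⁻¹ • q.im) = -1 := by
      have : q.im * q.im = -((‖q.im‖ * ‖q.im‖ : ℝ) : ℍ) := by
        rw [← Quaternion.normSq_eq_norm_mul_self, ← pow_two]
        exact Quaternion.sq_eq_neg_normSq.2 (Quaternion.re_im q)
      rw [smul_mul_smul_comm, this, smul_neg, ← Quaternion.coe_mul_eq_smul, ← Quaternion.coe_mul,
        ← mul_inv, inv_mul_cancel₀ (mul_ne_zero hn hn), Quaternion.coe_one]
    refine ⟨Complex.liftAux _ hI, ⟨q.re, ‖q.im‖⟩, ?_⟩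
    rw [Complex.liftAux_apply, smul_smul, mul_inv_cancel₀ hn, one_smul]
    exact Quaternion.re_add_im q

end Slices

/-! ### Transfer of complex spectral theory -/

section Spectrum

attribute [local instance] innerProductSpaceComplex

variable {H : Type*} [NormedAddCommGroup H] [QuaternionicInnerProductSpace H] [CompleteSpace H]

theorem algHom_mem_sphericalSpectrum_iff (T : BoundedOperator H) (φ : ℂ →ₐ[ℝ] ℍ) (z : ℂ) :
    φ z ∈ sphericalSpectrum T ↔ z ∈ spectrum ℂ (toComplex T) :=
  mem_sphericalSpectrum_iff T (re_algHom φ z) (norm_algHom φ z)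

variable [Nontrivial H]

/-- Spectral mapping for real polynomials. -/
theorem sphericalSpectrum_aeval (T : BoundedOperator H) (P : Polynomial ℝ) :
    sphericalSpectrum (Polynomial.aeval T P) =
      (fun q : ℍ => Polynomial.aeval q P) '' sphericalSpectrum T := by
  have key : spectrum ℂ (toComplex (Polynomial.aeval T P)) =
      (fun z : ℂ => Polynomial.aeval z P) '' spectrum ℂ (toComplex T) := by
    rw [toComplex_aeval, spectrum.map_polynomial_aeval]
    simp only [Polynomial.eval_map_algebraMap]
  ext q
  constructor
  · intro hq
    obtain ⟨φ, z, rfl⟩ := exists_algHom_apply_eq q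
    rw [algHom_mem_sphericalSpectrum_iff, key] at hq
    obtain ⟨w, hw, rfl⟩ := hq
    exact ⟨φ w, (algHom_mem_sphericalSpectrum_iff T φ w).2 hw, Polynomial.aeval_algHom_apply φ w P⟩
  · rintro ⟨p, hp, rfl⟩
    obtain ⟨φ, z, rfl⟩ := exists_algHom_apply_eq p
    rw [algHom_mem_sphericalSpectrum_iff] at hp
    dsimp only
    rw [Polynomial.aeval_algHom_apply, algHom_mem_sphericalSpectrum_iff, key]
    exact ⟨z, hp, rfl⟩

theorem sphericalSpectrum_pow (T : BoundedOperator H) (n : ℕ) :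
    sphericalSpectrum (T ^ n) = (fun q : ℍ => q ^ n) '' sphericalSpectrum T := by
  simpa using sphericalSpectrum_aeval T (Polynomial.X ^ n)

theorem sphericalSpectrum_nonempty (T : BoundedOperator H) : (sphericalSpectrum T).Nonempty := by
  obtain ⟨z, hz⟩ := spectrum.nonempty (toComplex T)
  exact ⟨_, (algHom_mem_sphericalSpectrum_iff T Quaternion.ofComplex z).2 hz⟩

theorem norm_le_of_mem_sphericalSpectrum (T : BoundedOperator H) {q : ℍ}
    (hq : q ∈ sphericalSpectrum T) : ‖q‖ ≤ ‖T‖ := by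
  obtain ⟨φ, z, rfl⟩ := exists_algHom_apply_eq q
  rw [norm_algHom, ← norm_toComplex]
  exact spectrum.norm_le_norm_of_mem ((algHom_mem_sphericalSpectrum_iff T φ z).1 hq)

omit [Nontrivial H] in
-- The point of the closed upper half plane with the real part and norm of `q` depends continuously
-- on `q`, so the complex spectrum can be pulled back.
theorem isClosed_sphericalSpectrum (T : BoundedOperator H) : IsClosed (sphericalSpectrum T) := by
  have h : sphericalSpectrum T = (fun q : ℍ => (q.re : ℂ) + (‖q.im‖ : ℂ) * Complex.I) ⁻¹'
      spectrum ℂ (toComplex T) := by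
    ext q
    refine mem_sphericalSpectrum_iff T (by simp) ?_
    refine (sq_eq_sq₀ (norm_nonneg _) (norm_nonneg _)).1 ?_
    rw [Complex.sq_norm, Complex.normSq_add_mul_I, pow_two, pow_two ‖q.im‖,
      ← Quaternion.normSq_eq_norm_mul_self, ← Quaternion.normSq_eq_norm_mul_self]
    simp only [Quaternion.normSq_def', Quaternion.re_im, Quaternion.imI_im, Quaternion.imJ_im,
      Quaternion.imK_im]
    ring
  rw [h]
  refine (spectrum.isClosed _).preimage ?_
  have := Quaternion.continuous_re
  have := Quaternion.continuous_im
  fun_prop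

theorem isCompact_sphericalSpectrum (T : BoundedOperator H) : IsCompact (sphericalSpectrum T) :=
  Metric.isCompact_of_isClosed_isBounded (isClosed_sphericalSpectrum T)
    (isBounded_iff_forall_norm_le.2 ⟨‖T‖, fun _ => norm_le_of_mem_sphericalSpectrum T⟩)

theorem sphericalSpectralRadius_le (T : BoundedOperator H) :
    sphericalSpectralRadius T ≤ ENNReal.ofReal ‖T‖ :=
  iSup₂_le fun _ hq => ENNReal.ofReal_le_ofReal (norm_le_of_mem_sphericalSpectrum T hq)

omit [Nontrivial H] in
theorem sphericalSpectralRadius_eq (T : BoundedOperator H) :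
    sphericalSpectralRadius T = spectralRadius ℂ (toComplex T) := by
  refine le_antisymm (iSup₂_le fun q hq => ?_) (iSup₂_le fun z hz => ?_)
  · obtain ⟨φ, z, rfl⟩ := exists_algHom_apply_eq q
    rw [norm_algHom, ofReal_norm]
    exact le_iSup₂ (f := fun (k : ℂ) (_ : k ∈ spectrum ℂ (toComplex T)) => (‖k‖₊ : ℝ≥0∞)) z
      ((algHom_mem_sphericalSpectrum_iff T φ z).1 hq)
  · have := le_iSup₂ (f := fun (k : ℍ) (_ : k ∈ sphericalSpectrum T) => ENNReal.ofReal ‖k‖) _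
      ((algHom_mem_sphericalSpectrum_iff T Quaternion.ofComplex z).2 hz)
    rwa [norm_algHom, ofReal_norm] at this

omit [Nontrivial H] in
/-- The Gelfand formula for the spherical spectral radius. -/
theorem tendsto_norm_pow_sphericalSpectralRadius (T : BoundedOperator H) :
    Filter.Tendsto (fun n : ℕ => ENNReal.ofReal (‖T ^ n‖ ^ (1 / (n : ℝ)))) Filter.atTop
      (𝓝 (sphericalSpectralRadius T)) := by
  have h := spectrum.pow_norm_pow_one_div_tendsto_nhds_spectralRadius (toComplex T)
  rw [← sphericalSpectralRadius_eq] at h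
  simpa only [← map_pow, norm_toComplex] using h

omit [Nontrivial H] in
theorem sphericalSpectralRadius_eq_of_isStarNormal (T : BoundedOperator H) (hT : IsStarNormal T) :
    sphericalSpectralRadius T = ENNReal.ofReal ‖T‖ := by
  have : IsStarNormal (toComplex T) := ⟨by
    rw [← toComplex_star]
    exact hT.star_comm_self.map toComplex⟩
  -- Bundles the existing structure, so that the C*-algebra result on normal elements applies.
  let _ : CStarAlgebra (H →L[ℂ] H) := {}
  rw [sphericalSpectralRadius_eq, IsStarNormal.spectralRadius_eq_nnnorm, ← norm_toComplex,
    ofReal_norm]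
  rfl

end Spectrum

/-! ### Power series of the inverse of `Δ_q(T)` -/

section PowerSeries

open scoped ComplexConjugate

/-- The coefficients of the expansion of `(X² - 2 (Re q) X + |q|²)⁻¹` in powers of `X`. -/
def resolventCoeff (q : ℍ) (n : ℕ) : ℝ :=
  (‖q‖ ^ (2 * n + 2))⁻¹ * (∑ h ∈ Finset.range (n + 1), q ^ h * star q ^ (n - h)).re

/-- Conjugation exchanges the terms of index `h` and `n - h`. This makes the coefficients real. -/
theorem star_sum_pow_mul_star_pow (q : ℍ) (n : ℕ) :
    star (∑ h ∈ Finset.range (n + 1), q ^ h * star q ^ (n - h)) =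
      ∑ h ∈ Finset.range (n + 1), q ^ h * star q ^ (n - h) := by
  rw [star_sum, ← Finset.sum_range_reflect]
  refine Finset.sum_congr rfl fun h hh => ?_
  have : h ≤ n := Nat.lt_succ_iff.1 (Finset.mem_range.1 hh)
  rw [star_mul, star_pow, star_pow, star_star, show n + 1 - 1 - h = n - h by omega,
    Nat.sub_sub_self this]

theorem coe_re_sum_pow_mul_star_pow (q : ℍ) (n : ℕ) :
    (((∑ h ∈ Finset.range (n + 1), q ^ h * star q ^ (n - h)).re : ℝ) : ℍ) =
      ∑ h ∈ Finset.range (n + 1), q ^ h * star q ^ (n - h) :=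
  (Quaternion.star_eq_self.1 (star_sum_pow_mul_star_pow q n)).symm

theorem coe_resolventCoeff (q : ℍ) (n : ℕ) :
    (resolventCoeff q n : ℍ) = (((‖q‖ ^ (2 * n + 2))⁻¹ : ℝ) : ℍ) *
      ∑ h ∈ Finset.range (n + 1), q ^ h * star q ^ (n - h) := by
  rw [resolventCoeff, Quaternion.coe_mul, coe_re_sum_pow_mul_star_pow]

theorem sum_pow_mul_star_pow_succ (q : ℍ) (n : ℕ) :
    ∑ h ∈ Finset.range (n + 2), q ^ h * star q ^ (n + 1 - h) =
      q * ∑ h ∈ Finset.range (n + 1), q ^ h * star q ^ (n - h) + star q ^ (n + 1) := by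
  rw [Finset.sum_range_succ', Finset.mul_sum]
  simp only [pow_zero, one_mul, Nat.sub_zero, Nat.add_sub_add_right, pow_succ' q, mul_assoc]

/-- Writing `S n` for the sum, `S (n+1) = q S n + q̄ ^ (n+1)`; using this at `n` and `n + 1`
eliminates the power of `q̄`. -/
theorem re_sum_pow_mul_star_pow_add_two (q : ℍ) (n : ℕ) :
    (∑ h ∈ Finset.range (n + 3), q ^ h * star q ^ (n + 2 - h)).re =
      2 * q.re * (∑ h ∈ Finset.range (n + 2), q ^ h * star q ^ (n + 1 - h)).re -
        ‖q‖ ^ 2 * (∑ h ∈ Finset.range (n + 1), q ^ h * star q ^ (n - h)).re := by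
  apply Quaternion.coe_injective
  have h1 := coe_re_sum_pow_mul_star_pow q (n + 2)
  have h2 := coe_re_sum_pow_mul_star_pow q (n + 1)
  have h3 := coe_re_sum_pow_mul_star_pow q n
  have e1 := sum_pow_mul_star_pow_succ q (n + 1)
  have e2 := sum_pow_mul_star_pow_succ q n
  have hs : ((2 * q.re : ℝ) : ℍ) = star q + q := by
    rw [Quaternion.coe_mul]; exact (Quaternion.star_add_self q).symm
  have hn : ((‖q‖ ^ 2 : ℝ) : ℍ) = star q * q := by
    rw [Quaternion.star_mul_self, Quaternion.normSq_eq_norm_mul_self, pow_two]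
  rw [Quaternion.coe_sub, Quaternion.coe_mul (2 * q.re), Quaternion.coe_mul (‖q‖ ^ 2), h1, h2,
    h3, hs, hn, e1,
    add_mul, mul_assoc (star q) q, eq_sub_of_add_eq e2.symm]
  rw [mul_sub, ← pow_succ']
  abel

/-- The sum has `n + 1` terms, each of norm `‖q‖ ^ n`. -/
theorem abs_resolventCoeff_le {q : ℍ} (hq : q ≠ 0) (n : ℕ) :
    |resolventCoeff q n| ≤ (‖q‖ ^ 2)⁻¹ * ((n + 1) * (‖q‖⁻¹) ^ n) := by
  have hpos : 0 < ‖q‖ := norm_pos_iff.2 hq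
  have h : ‖∑ h ∈ Finset.range (n + 1), q ^ h * star q ^ (n - h)‖ ≤ (n + 1) * ‖q‖ ^ n := by
    refine (norm_sum_le_of_le (f := fun h => q ^ h * star q ^ (n - h)) (n := fun _ => ‖q‖ ^ n) _
      fun h hh => ?_).trans (by simp)
    have : h ≤ n := Nat.lt_succ_iff.1 (Finset.mem_range.1 hh)
    rw [norm_mul, norm_pow, norm_pow, Quaternion.norm_star, ← pow_add, Nat.add_sub_cancel' this]
  rw [← coe_re_sum_pow_mul_star_pow, Quaternion.norm_coe, Real.norm_eq_abs] at h
  rw [resolventCoeff, abs_mul, abs_of_nonneg (by positivity)]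
  calc (‖q‖ ^ (2 * n + 2))⁻¹ * _ ≤ (‖q‖ ^ (2 * n + 2))⁻¹ * ((n + 1) * ‖q‖ ^ n) := by gcongr
    _ = _ := by
      rw [inv_pow]
      field_simp
      ring

theorem resolventCoeff_zero {q : ℍ} (hq : q ≠ 0) : ‖q‖ ^ 2 * resolventCoeff q 0 = 1 := by
  have : ‖q‖ ≠ 0 := norm_ne_zero_iff.2 hq
  simp [resolventCoeff, this]

theorem resolventCoeff_one {q : ℍ} (hq : q ≠ 0) :
    ‖q‖ ^ 2 * resolventCoeff q 1 = 2 * q.re * resolventCoeff q 0 := by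
  have : ‖q‖ ≠ 0 := norm_ne_zero_iff.2 hq
  simp only [resolventCoeff, Finset.sum_range_succ, Finset.sum_range_zero]
  simp
  field_simp
  ring

theorem resolventCoeff_add_two {q : ℍ} (hq : q ≠ 0) (n : ℕ) :
    ‖q‖ ^ 2 * resolventCoeff q (n + 2) =
      2 * q.re * resolventCoeff q (n + 1) - resolventCoeff q n := by
  have : ‖q‖ ≠ 0 := norm_ne_zero_iff.2 hq
  simp only [resolventCoeff]
  rw [re_sum_pow_mul_star_pow_add_two]
  field_simp
  ring

attribute [local instance] innerProductSpaceComplex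

variable {H : Type*} [NormedAddCommGroup H] [QuaternionicInnerProductSpace H]

theorem norm_smul_boundedOperator (r : ℝ) (T : BoundedOperator H) : ‖r • T‖ = |r| * ‖T‖ := by
  rw [← norm_toComplex, toComplex_real_smul, norm_smul, norm_toComplex, Complex.norm_real,
    Real.norm_eq_abs]

/-- The recurrence cancels every power of `T` from `1` to `n`; only the constant term and the two
top powers survive. -/
theorem Delta_mul_sum_range (T : BoundedOperator H) {q : ℍ} (hq : q ≠ 0) (n : ℕ) :
    Delta q T * ∑ i ∈ Finset.range (n + 1), resolventCoeff q i • T ^ i =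
      1 - (‖q‖ ^ 2 * resolventCoeff q (n + 1)) • T ^ (n + 1) +
        resolventCoeff q n • T ^ (n + 2) := by
  have hΔ (a : ℝ) (i : ℕ) : Delta q T * a • T ^ i =
      a • T ^ (i + 2) - (2 * q.re * a) • T ^ (i + 1) + (‖q‖ ^ 2 * a) • T ^ i := by
    rw [Delta, add_mul, sub_mul, mul_smul_comm, ← pow_add, smul_mul_smul_comm, smul_mul_smul_comm,
      one_mul, ← pow_succ', add_comm 2 i]
  induction n with
  | zero =>
    rw [zero_add, Finset.sum_range_one, hΔ, resolventCoeff_zero hq, resolventCoeff_one hq,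
      one_smul, pow_zero]
    abel
  | succ n ih =>
    rw [Finset.sum_range_succ, mul_add, ih, hΔ, resolventCoeff_add_two hq, sub_smul]
    abel

variable [CompleteSpace H] [Nontrivial H]

theorem isUnit_Delta (T : BoundedOperator H) {q : ℍ} (hq : ‖T‖ < ‖q‖) : IsUnit (Delta q T) :=
  isUnit_of_isUnit_toComplex ((mem_sphericalResolventSet_iff T q).1
    (not_not.1 fun h => hq.not_ge (norm_le_of_mem_sphericalSpectrum T h)))

omit [CompleteSpace H] in
theorem summable_norm_resolventCoeff_smul (T : BoundedOperator H) {q : ℍ} (hq : ‖T‖ < ‖q‖) :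
    Summable fun n : ℕ => ‖resolventCoeff q n • T ^ n‖ := by
  have hpos : 0 < ‖q‖ := (norm_nonneg T).trans_lt hq
  have hr : ‖‖T‖ / ‖q‖‖ < 1 := by
    rw [Real.norm_of_nonneg (by positivity)]
    exact (div_lt_one hpos).2 hq
  -- With `r = ‖T‖ / ‖q‖ < 1`, the majorant `(n + 1) r ^ n` splits into `n r ^ n` and `r ^ n`.
  have h0 := (summable_norm_pow_mul_geometric_of_norm_lt_one 0 hr).of_norm
  have h1 := (summable_norm_pow_mul_geometric_of_norm_lt_one 1 hr).of_norm
  refine Summable.of_nonneg_of_le (fun _ => norm_nonneg _) (fun n => ?_)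
    ((h1.add h0).mul_left (‖q‖ ^ 2)⁻¹)
  have hT : ‖T ^ n‖ ≤ ‖T‖ ^ n := by
    rw [← norm_toComplex, ← norm_toComplex T, map_pow]
    exact norm_pow_le _ _
  rw [norm_smul_boundedOperator]
  calc _ ≤ (‖q‖ ^ 2)⁻¹ * ((n + 1) * (‖q‖⁻¹) ^ n) * ‖T‖ ^ n :=
        mul_le_mul (abs_resolventCoeff_le (norm_pos_iff.1 hpos) n) hT (norm_nonneg _)
          (by positivity)
    _ = _ := by
      rw [div_eq_mul_inv, mul_pow]
      ring

theorem hasSum_resolventCoeff_smul (T : BoundedOperator H) {q : ℍ} (hq : ‖T‖ < ‖q‖) :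
    HasSum (fun n : ℕ => resolventCoeff q n • T ^ n) (Ring.inverse (Delta q T)) := by
  have hq0 : q ≠ 0 := norm_pos_iff.1 ((norm_nonneg T).trans_lt hq)
  have hs := summable_norm_resolventCoeff_smul T hq
  rw [hasSum_iff_tendsto_nat_of_summable_norm hs, ← Filter.tendsto_add_atTop_iff_nat 1]
  have h0 : Filter.Tendsto (fun n : ℕ => resolventCoeff q n • T ^ n) Filter.atTop (𝓝 0) :=
    tendsto_zero_iff_norm_tendsto_zero.2 hs.tendsto_atTop_zero
  have h1 := ((tendsto_const_nhds (x := (1 : BoundedOperator H))).sub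
    (((Filter.tendsto_add_atTop_iff_nat 1).2 h0).const_mul (algebraMap ℝ _ (‖q‖ ^ 2)))).add
    (h0.mul_const (T ^ 2))
  -- The products of `Δ_q(T)` with the partial sums tend to `1`; applying the inverse recovers the
  -- partial sums themselves.
  have h2 := h1.const_mul (Ring.inverse (Delta q T))
  rw [mul_zero, zero_mul, sub_zero, add_zero, mul_one] at h2
  refine h2.congr fun n => ?_
  rw [← Algebra.smul_def, smul_smul, smul_mul_assoc, ← pow_add, ← Delta_mul_sum_range T hq0,
    Ring.inverse_mul_cancel_left _ _ (isUnit_Delta T hq)]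

end PowerSeries

end QuaternionicHilbert

end

theorem mainTheorem8 {H : Type*} [NormedAddCommGroup H] [QuaternionicInnerProductSpace H]
    [CompleteSpace H] [Nontrivial H] (T : BoundedOperator H) :
    -- (a) power series of the inverse of `Δ_q(T)` for `|q| > ‖T‖`
    (∀ q : ℍ, ‖T‖ < ‖q‖ →
      ∃ a : ℕ → ℝ,
        (∀ n : ℕ, (a n : ℍ) = (((‖q‖ ^ (2 * n + 2))⁻¹ : ℝ) : ℍ) *
          ∑ h ∈ Finset.range (n + 1), q ^ h * star q ^ (n - h)) ∧
        Summable (fun n : ℕ => ‖a n • T ^ n‖) ∧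
        IsUnit (Delta q T) ∧
        HasSum (fun n : ℕ => a n • T ^ n) (Ring.inverse (Delta q T))) ∧
    sphericalSpectralRadius T ≤ ENNReal.ofReal ‖T‖ ∧
    -- (b)
    (sphericalSpectrum T).Nonempty ∧ IsCompact (sphericalSpectrum T) ∧
    -- (c)
    (IsSelfAdjoint T → ∀ P : Polynomial ℝ,
      sphericalSpectrum (Polynomial.aeval T P) =
        (fun q : ℍ => Polynomial.aeval q P) '' sphericalSpectrum T) ∧
    -- (d)
    (∀ n : ℕ, sphericalSpectrum (T ^ n) = (fun q : ℍ => q ^ n) '' sphericalSpectrum T) ∧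
    -- (e)
    Filter.Tendsto (fun n : ℕ => ENNReal.ofReal (‖T ^ n‖ ^ (1 / (n : ℝ)))) Filter.atTop
      (𝓝 (sphericalSpectralRadius T)) ∧
    (IsStarNormal T → sphericalSpectralRadius T = ENNReal.ofReal ‖T‖) :=
  ⟨fun q hq => ⟨resolventCoeff q, coe_resolventCoeff q, summable_norm_resolventCoeff_smul T hq,
      isUnit_Delta T hq, hasSum_resolventCoeff_smul T hq⟩,
    sphericalSpectralRadius_le T, sphericalSpectrum_nonempty T, isCompact_sphericalSpectrum T,
    fun _ => sphericalSpectrum_aeval T, sphericalSpectrum_pow T,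
    tendsto_norm_pow_sphericalSpectralRadius T, sphericalSpectralRadius_eq_of_isStarNormal T⟩
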